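/- Let $\beta\in(0,1)$, $\gamma<0$, and let $(q_k)_{k\in\mathbb Z}$ be the distribution of an integer-valued random variable $Z$ with $\mathbb E Z^+<\infty$ and $\mathbb P(Z<0)>0$. Consider the surplus process with state space $\mathbb Z$: in state $x$ the insurer pays a dividend $a\in A(x)$, where $A(x)=\{0,\dots,x\}$ if $x\ge 0$ and $A(x)=\{0\}$ if $x<0$. If $x\ge 0$, the next state is distributed as $x-a+Z$ (independently of the past); if $x<0$ (ruin), the state remains $x$ forever. A policy $\pi=(\pi_k)_{k\ge0}$ is history-dependent: $\pi_k$ maps each history $(x_0,a_0,\dots,x_{k-1},a_{k-1},x_k)$, with $a_j\in A(x_j)$, to an element of $A(x_k)$; it is Markov if $\pi_k$ depends on $x_k$ only. Let $\Pi$ be the set of all history-dependent policies, and let $\mathbb E_x^\pi$ be the expectation with respect to the law of $(x_k,a_k)_{k\ge0}$ under $\pi\in\Pi$ and $x_0=x$. For $x\in\mathbb Z$ and $\theta\in[\gamma,0)$ put $$J_\pi(x,\theta)=\mathbb E_x^\pi\exp\Big(\theta\sum_{k=0}^\infty\beta^k a_k\Big),\qquad J(x,\theta)=\inf_{\pi\in\Pi}J_\pi(x,\theta),$$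 and, with $U_\gamma(s)=\frac1\gamma e^{\gamma s}$, $$\widetilde J_\pi(x)=\mathbb E_x^\pi\,U_\gamma\Big(\sum_{k=0}^\infty\beta^k a_k\Big),\qquad \widetilde J(x)=\sup_{\pi\in\Pi}\widetilde J_\pi(x).$$ For $x\ge0$ and $\theta\in[\gamma,0)$ let $G(x,\theta)=\sum_{k\ge -x}J(x+k,\theta)\,q_k+\sum_{k<-x}q_k$, and let $f^*(x,\theta)$ be the largest minimiser of $a\mapsto e^{\theta a}G(x-a,\theta\beta)$ over $a\in A(x)$; for $x<0$ let $f^*(x,\theta)=0$. Then the Markov policy $\pi^*=(f^*(\cdot,\gamma\beta^n))_{n\ge0}$ is optimal over all history-dependent policies, that is, for every $x\in\mathbb Z$, $$\widetilde J(x)=\widetilde J_{\pi^*}(x)=\frac1\gamma J_{\pi^*}(x,\gamma)=\frac1\gamma J(x,\gamma).$$ -/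

import Mathlib

open MeasureTheory ProbabilityTheory
open scoped ENNReal

noncomputable section

namespace Dividend

/-- The dividends `A(x)` available at surplus `x`: `{0, …, x}` if `x ≥ 0`, and `{0}` if `x < 0`. -/
def actions (x : ℤ) : Finset ℕ := Finset.range (x.toNat + 1)

/-- The set `D` of admissible pairs (surplus, dividend). -/
abbrev Pair : Type := {p : ℤ × ℕ // p.2 ∈ actions p.1}

/-- The surplus component of an admissible pair. -/
def Pair.surplus (p : Pair) : ℤ := p.1.1

/-- The dividend component of an admissible pair; this is also the one-step reward `r(x, a) = a`. -/
def Pair.dividend (p : Pair) : ℕ := p.1.2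

/-- The decision rules `Γ`: maps `g` from surpluses to dividends with `g x ∈ A(x)`. -/
abbrev DecisionRule : Type := (x : ℤ) → {a : ℕ // a ∈ actions x}

/-- History-dependent policies. The history up to time `k` is `(x₀, a₀, …, x_{k-1}, a_{k-1}, x_k)`,
an element of `D^k × ℤ`, and the chosen dividend has to lie in `A(x_k)`. -/
abbrev Policy : Type := (k : ℕ) → (Fin k → Pair) → DecisionRule

/-- The Markov policy given by a sequence of decision rules. -/
def markovPolicy (g : ℕ → DecisionRule) : Policy := fun k _ => g k

/-- The admissible pair chosen by a policy at time `k`, after the past `h`, at surplus `x`. -/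
def Policy.pair (π : Policy) (k : ℕ) (h : Fin k → Pair) (x : ℤ) : Pair :=
  ⟨(x, (π k h x : ℕ)), (π k h x).2⟩

/-- The law `q(· | x, a)` of the next surplus: the law of `x - a + Z` with `Z ~ q` if `x ≥ 0`,
and the point mass at `x` if `x < 0`. -/
def transition (q : PMF ℤ) (p : Pair) : PMF ℤ :=
  if 0 ≤ p.surplus then q.map (fun z => p.surplus - (p.dividend : ℤ) + z) else PMF.pure p.surplus

/-- The law of the pair `(x_{k+1}, a_{k+1})` given the pairs at times `0, …, k`, under `π`. -/
def stepKernel (q : PMF ℤ) (π : Policy) (k : ℕ) :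
    Kernel ((_ : Finset.Iic k) → Pair) Pair where
  toFun h := ((transition q (h ⟨k, Finset.mem_Iic.2 le_rfl⟩)).map
    (π.pair (k + 1)
      (fun i => h ⟨(i : ℕ), Finset.mem_Iic.2 (Nat.lt_succ_iff.1 i.2)⟩))).toMeasure
  measurable' := measurable_of_countable _

instance (q : PMF ℤ) (π : Policy) (k : ℕ) : IsMarkovKernel (stepKernel q π k) :=
  ⟨fun h => by
    change IsProbabilityMeasure (PMF.toMeasure _)
    infer_instance⟩

/-- The Ionescu-Tulcea measure on `D^ℕ`: the law of `(x_k, a_k)_k` under the policy `π` from the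
initial surplus `x`. -/
def law (q : PMF ℤ) (π : Policy) (x : ℤ) : Measure (ℕ → Pair) :=
  Kernel.traj (X := fun _ => Pair) (stepKernel q π) 0 (fun _ => π.pair 0 Fin.elim0 x)

/-- The total discounted dividends `∑ β^k a_k`, a sum of nonnegative terms, in `[0, ∞]`. -/
def total (β : ℝ) (ω : ℕ → Pair) : ℝ≥0∞ :=
  ∑' k, ENNReal.ofReal (β ^ k * ((ω k).dividend : ℝ))

/-- `e^{θ s}` for `θ < 0` and `s ∈ [0, ∞]`, with `e^{-∞} = 0`. -/
def expMul (θ : ℝ) (s : ℝ≥0∞) : ℝ := if s = ∞ then 0 else Real.exp (θ * s.toReal)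

/-- The exponential utility `U_γ(s) = e^{γ s} / γ`, for `γ < 0`. -/
def utility (γ : ℝ) (s : ℝ≥0∞) : ℝ := 1 / γ * expMul γ s

/-- The expected utility `J̃_π(x)` of the discounted dividends. -/
def expectedUtility (q : PMF ℤ) (β γ : ℝ) (π : Policy) (x : ℤ) : ℝ :=
  ∫ ω, utility γ (total β ω) ∂(law q π x)

/-- The optimal expected utility `J̃(x)`. -/
def optimalUtility (q : PMF ℤ) (β γ : ℝ) (x : ℤ) : ℝ :=
  ⨆ π : Policy, expectedUtility q β γ π x

/-- `J_π(x, θ)`, the expectation of `exp (θ ∑ β^k a_k)`. -/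
def costOf (q : PMF ℤ) (β : ℝ) (π : Policy) (x : ℤ) (θ : ℝ) : ℝ :=
  ∫ ω, expMul θ (total β ω) ∂(law q π x)

/-- `J(x, θ)`, the infimum of `J_π(x, θ)` over all history-dependent policies. -/
def cost (q : PMF ℤ) (β : ℝ) (x : ℤ) (θ : ℝ) : ℝ := ⨅ π : Policy, costOf q β π x θ

/-- `G(x, θ) = ∑_{k ≥ -x} J(x + k, θ) q_k + ∑_{k < -x} q_k`. -/
def costAfter (q : PMF ℤ) (β : ℝ) (x : ℤ) (θ : ℝ) : ℝ :=
  ∑' k : ℤ, (if -x ≤ k then cost q β (x + k) θ else 1) * (q k).toReal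

/-- The expression `e^{θ a} G(x - a, θ β)` minimised over `a ∈ A(x)` in the optimality equation
`J(x, θ) = min_{a ∈ A(x)} e^{θ a} G(x - a, θ β)`. -/
def objective (q : PMF ℤ) (β : ℝ) (x : ℤ) (θ : ℝ) (a : ℕ) : ℝ :=
  Real.exp (θ * a) * costAfter q β (x - a) (θ * β)

/-- The minimisers over `A(x)` in the optimality equation. -/
def minimisers (q : PMF ℤ) (β : ℝ) (x : ℤ) (θ : ℝ) : Set ℕ :=
  {a | a ∈ actions x ∧ ∀ b ∈ actions x, objective q β x θ a ≤ objective q β x θ b}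

/-- The largest minimiser `f^*(x, θ)`; it is `0` for `x < 0`, as then `A(x) = {0}`. -/
def largestMinimiser (q : PMF ℤ) (β : ℝ) (x : ℤ) (θ : ℝ) : ℕ := sSup (minimisers q β x θ)

theorem largestMinimiser_isGreatest (q : PMF ℤ) (β : ℝ) (x : ℤ) (θ : ℝ) :
    IsGreatest (minimisers q β x θ) (largestMinimiser q β x θ) := by
  have hb : BddAbove (minimisers q β x θ) :=
    ⟨x.toNat, fun a ha => Nat.lt_succ_iff.1 (Finset.mem_range.1 ha.1)⟩
  have hn : (minimisers q β x θ).Nonempty := by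
    obtain ⟨a, ha, h⟩ := Finset.exists_min_image (actions x) (objective q β x θ)
      ⟨0, Finset.mem_range.2 (Nat.succ_pos _)⟩
    exact ⟨a, ha, h⟩
  exact ⟨Nat.sSup_mem hn hb, fun a ha => le_csSup hb ha⟩

/-- The Markov policy `π^* = (f^*(·, γ β^n))_n`. -/
def optimalPolicy (q : PMF ℤ) (β γ : ℝ) : Policy :=
  markovPolicy (fun n x => ⟨largestMinimiser q β x (γ * β ^ n),
    (largestMinimiser_isGreatest q β x (γ * β ^ n)).1.1⟩)

end Dividend

end

/-!
The optimal cost `J` is identified with an explicit solution of the optimality equation, and every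
policy that picks minimisers in that equation is shown to attain it.

Value iteration started at the constant `1` decreases to a limit `W` (`valueLimit`), which solves
`W(x, θ) = min_{a ∈ A(x)} e^{θ a} E W(x', θ β)` (`bellman_valueLimit`). For a policy `π` let
`N_k = e^{θ (a_0 + ⋯ + β^k a_k)} W̄`, where `W̄` is the mean of `W(x_{k+1}, θ β^{k+1})` given
`(x_k, a_k)` (`costToGo`). By the optimality equation and the one-step conditioning formula
`integral_step` for the Ionescu-Tulcea measure, `E N_k` is nondecreasing in `k`, with
`E N_0 ≥ W(x, θ)`; for a Markov policy of minimisers both relations are equalities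
(`integral_costToGo_of_isGreedy`). Since `W ≤ 1`, letting `k → ∞` gives `W ≤ J_π` for every
history-dependent `π` (`valueLimit_le_costOf`).

Equality for a policy of minimisers (`costOf_of_isGreedy`) needs that stopping the product at time
`k` loses nothing in the limit. Here `E Z⁺ < ∞` enters: value iteration preserves the bound
`1 - W(x, θ) ≤ |θ| (x⁺ + C)` (`one_sub_valueIter_le`), and `E x_k⁺ ≤ x⁺ + k E Z⁺`
(`lintegral_surplus_le`), so the loss is at most a constant times `β^k (k + 1)`.

As policies of minimisers exist for every `θ < 0`, it follows that `J = W`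
(`cost_eq_valueLimit`). Hence the minimisation that defines `f^*` is the one in the optimality
equation for `W` (`objective_eq_actionValue`), `π^*` is itself a policy of minimisers, and it
attains `J`. Multiplication by `1 / γ < 0` turns the minimum of the cost into the maximum of the
expected utility.
-/

namespace Dividend

open Filter Topology

/-! ### Averages over the next surplus -/

/-- The expectation of `w` at the next surplus, given the present surplus and dividend. -/
noncomputable def expectAfter (q : PMF ℤ) (w : ℤ → ℝ) (p : Pair) : ℝ :=
  ∫ y, w y ∂(transition q p).toMeasure

theorem integrable_of_mem_Icc {α : Type*} [MeasurableSpace α] {μ : Measure α}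
    [IsFiniteMeasure μ] {f : α → ℝ} (hf : Measurable f) (h : ∀ y, f y ∈ Set.Icc (0 : ℝ) 1) :
    Integrable f μ :=
  Integrable.of_bound hf.aestronglyMeasurable 1
    (.of_forall fun y => by rw [Real.norm_of_nonneg (h y).1]; exact (h y).2)

theorem integral_mem_Icc {α : Type*} [MeasurableSpace α] {μ : Measure α}
    [IsProbabilityMeasure μ] {f : α → ℝ} (hf : Measurable f)
    (h : ∀ y, f y ∈ Set.Icc (0 : ℝ) 1) : ∫ y, f y ∂μ ∈ Set.Icc (0 : ℝ) 1 := by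
  refine ⟨integral_nonneg fun y => (h y).1, ?_⟩
  calc ∫ y, f y ∂μ ≤ ∫ _, (1 : ℝ) ∂μ :=
        integral_mono (integrable_of_mem_Icc hf h) (integrable_const 1) fun y => (h y).2
    _ = 1 := by simp

theorem expectAfter_mem_Icc (q : PMF ℤ) {w : ℤ → ℝ} (h : ∀ y, w y ∈ Set.Icc (0 : ℝ) 1)
    (p : Pair) : expectAfter q w p ∈ Set.Icc (0 : ℝ) 1 :=
  integral_mem_Icc (measurable_of_countable w) h

theorem expectAfter_mono (q : PMF ℤ) {w w' : ℤ → ℝ} (h : ∀ y, w y ∈ Set.Icc (0 : ℝ) 1)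
    (h' : ∀ y, w' y ∈ Set.Icc (0 : ℝ) 1) (hw : ∀ y, w y ≤ w' y) (p : Pair) :
    expectAfter q w p ≤ expectAfter q w' p :=
  integral_mono (integrable_of_mem_Icc (measurable_of_countable _) h)
    (integrable_of_mem_Icc (measurable_of_countable _) h') hw

/-- The mean of the positive part of a random variable with law `q`. -/
noncomputable def meanPos (q : PMF ℤ) : ℝ := ∫ z : ℤ, ((max z 0 : ℤ) : ℝ) ∂q.toMeasure

theorem meanPos_nonneg (q : PMF ℤ) : 0 ≤ meanPos q :=
  integral_nonneg fun z => by simp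

theorem dividend_le (p : Pair) : p.dividend ≤ p.surplus.toNat :=
  Nat.lt_succ_iff.1 (Finset.mem_range.1 p.2)

theorem expectAfter_of_neg (q : PMF ℤ) (w : ℤ → ℝ) {p : Pair} (hp : p.surplus < 0) :
    expectAfter q w p = w p.surplus := by
  rw [expectAfter, transition, if_neg (not_le.2 hp), PMF.toMeasure_pure, integral_dirac]

theorem expectAfter_of_nonneg (q : PMF ℤ) (w : ℤ → ℝ) {p : Pair} (hp : 0 ≤ p.surplus) :
    expectAfter q w p = ∫ z, w (p.surplus - (p.dividend : ℤ) + z) ∂q.toMeasure := by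
  rw [expectAfter, transition, if_pos hp, ← PMF.toMeasure_map _ _ (measurable_of_countable _),
    integral_map (measurable_of_countable _).aemeasurable
      (measurable_of_countable _).aestronglyMeasurable]

/-- The positive part of the surplus grows in one step by at most `E Z⁺ - a` on average. -/
theorem lintegral_toNat_transition_le (q : PMF ℤ)
    (hq : Integrable (fun z : ℤ => ((max z 0 : ℤ) : ℝ)) q.toMeasure) (p : Pair) :
    ∫⁻ y, ENNReal.ofReal (y.toNat : ℝ) ∂(transition q p).toMeasure ≤
      ENNReal.ofReal (p.surplus.toNat - p.dividend + meanPos q) := by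
  have hd : (p.dividend : ℝ) ≤ p.surplus.toNat := by exact_mod_cast dividend_le p
  rcases lt_or_ge p.surplus 0 with hp | hp
  · rw [transition, if_neg (not_le.2 hp), PMF.toMeasure_pure, lintegral_dirac]
    simp [Int.toNat_of_nonpos hp.le]
  · rw [transition, if_pos hp, ← PMF.toMeasure_map _ _ (measurable_of_countable _),
      lintegral_map (measurable_of_countable _) (measurable_of_countable _),
      ENNReal.ofReal_add (by linarith) (meanPos_nonneg q), meanPos,
      ofReal_integral_eq_lintegral_ofReal hq (.of_forall fun z => by simp)]
    calc _ ≤ ∫⁻ z, (ENNReal.ofReal ((p.surplus.toNat : ℝ) - p.dividend) +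
              ENNReal.ofReal ((max z 0 : ℤ) : ℝ)) ∂q.toMeasure := by
            refine lintegral_mono fun z => ?_
            rw [← ENNReal.ofReal_add (by linarith) (by simp)]
            refine ENNReal.ofReal_le_ofReal ?_
            have h1 : ((p.surplus - (p.dividend : ℤ) + z).toNat : ℤ) ≤
                (p.surplus.toNat : ℤ) - p.dividend + max z 0 := by
              have := dividend_le p
              omega
            exact_mod_cast h1
      _ = _ := by
            rw [lintegral_add_left measurable_const, lintegral_const, measure_univ, mul_one]

/-- A function within `t (y⁺ + c)` of `1` averages to a number within `t (y⁺ - a + E Z⁺ + c)`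
of `1`. -/
theorem one_sub_expectAfter_le (q : PMF ℤ)
    (hq : Integrable (fun z : ℤ => ((max z 0 : ℤ) : ℝ)) q.toMeasure) {w : ℤ → ℝ} {t c : ℝ}
    (ht : 0 ≤ t) (h : ∀ y, w y ∈ Set.Icc (0 : ℝ) 1)
    (hw : ∀ y, 1 - w y ≤ t * (y.toNat + c)) (p : Pair) :
    1 - expectAfter q w p ≤ t * (p.surplus.toNat - p.dividend + meanPos q + c) := by
  have hd : (p.dividend : ℝ) ≤ p.surplus.toNat := by exact_mod_cast dividend_le p
  have hm := meanPos_nonneg q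
  have hwi : Integrable w (transition q p).toMeasure :=
    integrable_of_mem_Icc (measurable_of_countable _) h
  have hy := lintegral_toNat_transition_le q hq p
  have hi : Integrable (fun y : ℤ => (y.toNat : ℝ)) (transition q p).toMeasure := by
    refine ⟨(measurable_of_countable _).aestronglyMeasurable, ?_⟩
    rw [hasFiniteIntegral_iff_ofReal (.of_forall fun y => by positivity)]
    exact hy.trans_lt ENNReal.ofReal_lt_top
  have hy' : ∫ y : ℤ, (y.toNat : ℝ) ∂(transition q p).toMeasure ≤
      p.surplus.toNat - p.dividend + meanPos q := by
    rw [integral_eq_lintegral_of_nonneg_ae (.of_forall fun y => by positivity)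
      (measurable_of_countable _).aestronglyMeasurable]
    exact ENNReal.toReal_le_of_le_ofReal (by linarith) hy
  calc 1 - expectAfter q w p = ∫ y, (1 - w y) ∂(transition q p).toMeasure := by
        rw [integral_sub (integrable_const 1) hwi]; simp [expectAfter]
    _ ≤ ∫ y : ℤ, t * (y.toNat + c) ∂(transition q p).toMeasure :=
        integral_mono ((integrable_const 1).sub hwi)
          ((hi.add (integrable_const c)).const_mul t) hw
    _ = t * (∫ y : ℤ, (y.toNat : ℝ) ∂(transition q p).toMeasure + c) := by
        rw [integral_const_mul, integral_add hi (integrable_const c)]; simp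
    _ ≤ _ := mul_le_mul_of_nonneg_left (by linarith) ht

/-! ### The optimality operator and value iteration -/

/-- The admissible pair of surplus `x` and dividend `a ∈ A(x)`. -/
def pairOf (x : ℤ) (a : {a : ℕ // a ∈ actions x}) : Pair := ⟨(x, a), a.2⟩

instance (x : ℤ) : Nonempty {a : ℕ // a ∈ actions x} :=
  ⟨0, Finset.mem_range.2 (Nat.succ_pos _)⟩

/-- `e^{θ a} E W(x', θ β)`, with `x'` the surplus that follows the pair `p = (x, a)`. -/
noncomputable def actionValue (q : PMF ℤ) (β : ℝ) (W : ℤ → ℝ → ℝ) (θ : ℝ) (p : Pair) : ℝ :=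
  Real.exp (θ * p.dividend) * expectAfter q (fun y => W y (θ * β)) p

/-- The right-hand side of the optimality equation: the least value of an action at `x`. -/
noncomputable def bellman (q : PMF ℤ) (β : ℝ) (W : ℤ → ℝ → ℝ) (x : ℤ) (θ : ℝ) : ℝ :=
  Finset.univ.inf' Finset.univ_nonempty fun a => actionValue q β W θ (pairOf x a)

/-- A cost function with values in `[0, 1]` at all nonpositive parameters. -/
def UnitValued (W : ℤ → ℝ → ℝ) : Prop := ∀ x, ∀ θ ≤ 0, W x θ ∈ Set.Icc (0 : ℝ) 1

section Bellman

variable {q : PMF ℤ} {β : ℝ} {W W' : ℤ → ℝ → ℝ}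

theorem exp_mul_mem_Icc {s c θ : ℝ} (hθ : θ ≤ 0) (hs : 0 ≤ s) (hc : c ∈ Set.Icc (0 : ℝ) 1) :
    Real.exp (θ * s) * c ∈ Set.Icc (0 : ℝ) 1 :=
  ⟨mul_nonneg (Real.exp_pos _).le hc.1, mul_le_one₀
    (Real.exp_le_one_iff.2 (mul_nonpos_of_nonpos_of_nonneg hθ hs)) hc.1 hc.2⟩

theorem UnitValued.actionValue_mem_Icc (hW : UnitValued W) (hβ : 0 ≤ β) {θ : ℝ} (hθ : θ ≤ 0)
    (p : Pair) : actionValue q β W θ p ∈ Set.Icc (0 : ℝ) 1 :=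
  exp_mul_mem_Icc hθ (Nat.cast_nonneg _) (expectAfter_mem_Icc q
    (fun y => hW y _ (mul_nonpos_of_nonpos_of_nonneg hθ hβ)) p)

theorem UnitValued.bellman (hW : UnitValued W) (hβ : 0 ≤ β) : UnitValued (bellman q β W) := by
  intro x θ hθ
  refine ⟨Finset.le_inf' _ _ fun a _ => (hW.actionValue_mem_Icc hβ hθ _).1, ?_⟩
  exact (Finset.inf'_le _ (Finset.mem_univ (Classical.arbitrary _))).trans
    (hW.actionValue_mem_Icc hβ hθ _).2

theorem bellman_mono (hβ : 0 ≤ β) (hW : UnitValued W) (hW' : UnitValued W')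
    (h : ∀ x, ∀ θ ≤ 0, W x θ ≤ W' x θ) (x : ℤ) (θ : ℝ) (hθ : θ ≤ 0) :
    bellman q β W x θ ≤ bellman q β W' x θ := by
  have hθβ := mul_nonpos_of_nonpos_of_nonneg hθ hβ
  refine Finset.inf'_mono_fun fun a _ => ?_
  exact mul_le_mul_of_nonneg_left (expectAfter_mono q (fun y => hW y _ hθβ)
    (fun y => hW' y _ hθβ) (fun y => h y _ hθβ) _) (Real.exp_pos _).le

/-- The costs of the problems with finitely many dividend payments, by backward induction. -/
noncomputable def valueIter (q : PMF ℤ) (β : ℝ) : ℕ → ℤ → ℝ → ℝ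
  | 0 => fun _ _ => 1
  | n + 1 => bellman q β (valueIter q β n)

theorem unitValued_valueIter (hβ : 0 ≤ β) (n : ℕ) : UnitValued (valueIter q β n) := by
  induction n with
  | zero => exact fun _ _ _ => by simp [valueIter]
  | succ n ih => exact ih.bellman hβ

theorem valueIter_succ_le (hβ : 0 ≤ β) (n : ℕ) :
    ∀ x, ∀ θ ≤ 0, valueIter q β (n + 1) x θ ≤ valueIter q β n x θ := by
  induction n with
  | zero => exact fun x θ hθ => (unitValued_valueIter hβ 1 x θ hθ).2
  | succ n ih =>
    exact bellman_mono hβ (unitValued_valueIter hβ _) (unitValued_valueIter hβ _) ih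

/-- The sum `β E Z⁺ + β² E Z⁺ + ⋯`, a bound on the expected discounted dividends from future
income. -/
noncomputable def incomeBound (q : PMF ℤ) (β : ℝ) : ℝ := β * meanPos q / (1 - β)

theorem incomeBound_nonneg (hβ : 0 ≤ β) (hβ₁ : β < 1) : 0 ≤ incomeBound q β :=
  div_nonneg (mul_nonneg hβ (meanPos_nonneg q)) (by linarith)

/-- The costs are close to `1` for `θ` near `0`, at a rate that is linear in the surplus. -/
theorem one_sub_valueIter_le (hβ : 0 ≤ β) (hβ₁ : β < 1)
    (hq : Integrable (fun z : ℤ => ((max z 0 : ℤ) : ℝ)) q.toMeasure) (n : ℕ) :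
    ∀ x, ∀ θ ≤ 0, 1 - valueIter q β n x θ ≤ -θ * (x.toNat + incomeBound q β) := by
  have hC := incomeBound_nonneg (q := q) hβ hβ₁
  induction n with
  | zero =>
    intro x θ hθ
    have : 0 ≤ -θ * (x.toNat + incomeBound q β) :=
      mul_nonneg (by linarith) (by positivity)
    simpa [valueIter] using this
  | succ n ih =>
    intro x θ hθ
    have hθβ := mul_nonpos_of_nonpos_of_nonneg hθ hβ
    suffices h : ∀ p : Pair, 1 - actionValue q β (valueIter q β n) θ p ≤
        -θ * (p.surplus.toNat + incomeBound q β) by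
      have h1 : 1 - -θ * (x.toNat + incomeBound q β) ≤ valueIter q β (n + 1) x θ :=
        Finset.le_inf' Finset.univ_nonempty _ fun a _ => by
          have : 1 - _ ≤ -θ * (x.toNat + incomeBound q β) := h (pairOf x a)
          linarith
      linarith
    intro p
    have hd : (p.dividend : ℝ) ≤ p.surplus.toNat := by exact_mod_cast dividend_le p
    have hE := expectAfter_mem_Icc q (fun y => unitValued_valueIter (q := q) hβ n y _ hθβ) p
    have h1 := one_sub_expectAfter_le q hq (t := -(θ * β)) (by linarith)
      (fun y => unitValued_valueIter (q := q) hβ n y _ hθβ) (fun y => ih y _ hθβ) p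
    have h2 : 1 - Real.exp (θ * p.dividend) ≤ -θ * p.dividend := by
      have := Real.add_one_le_exp (θ * p.dividend)
      linarith
    have h3 : Real.exp (θ * p.dividend) ≤ 1 :=
      Real.exp_le_one_iff.2 (mul_nonpos_of_nonpos_of_nonneg hθ (Nat.cast_nonneg _))
    have hfix : β * (meanPos q + incomeBound q β) = incomeBound q β := by
      have : 1 - β ≠ 0 := by linarith
      unfold incomeBound
      field_simp
      ring
    have h4 : -(θ * β) * (p.surplus.toNat - p.dividend + meanPos q + incomeBound q β) ≤
        -θ * (p.surplus.toNat - p.dividend + incomeBound q β) := by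
      have : 0 ≤ (-θ) * ((1 - β) * (p.surplus.toNat - p.dividend)) :=
        mul_nonneg (by linarith) (mul_nonneg (by linarith) (by linarith))
      have h5 : -(θ * β) * (p.surplus.toNat - p.dividend + meanPos q + incomeBound q β) =
        -θ * (β * (p.surplus.toNat - p.dividend) + β * (meanPos q + incomeBound q β)) := by ring
      rw [h5, hfix]
      linarith
    have h6 := mul_nonneg (sub_nonneg.2 h3) (sub_nonneg.2 hE.2)
    unfold actionValue
    linarith

/-- The limit of value iteration. -/
noncomputable def valueLimit (q : PMF ℤ) (β : ℝ) (x : ℤ) (θ : ℝ) : ℝ :=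
  ⨅ n, valueIter q β n x θ

theorem tendsto_valueIter (hβ : 0 ≤ β) (x : ℤ) {θ : ℝ} (hθ : θ ≤ 0) :
    Tendsto (fun n => valueIter q β n x θ) atTop (𝓝 (valueLimit q β x θ)) :=
  tendsto_atTop_ciInf (antitone_nat_of_succ_le fun n => valueIter_succ_le hβ n x θ hθ)
    ⟨0, by rintro _ ⟨n, rfl⟩; exact (unitValued_valueIter hβ n x θ hθ).1⟩

theorem unitValued_valueLimit (hβ : 0 ≤ β) : UnitValued (valueLimit q β) := fun x _ hθ =>
  isClosed_Icc.mem_of_tendsto (tendsto_valueIter hβ x hθ)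
    (.of_forall fun n => unitValued_valueIter hβ n x _ hθ)

theorem one_sub_valueLimit_le (hβ : 0 ≤ β) (hβ₁ : β < 1)
    (hq : Integrable (fun z : ℤ => ((max z 0 : ℤ) : ℝ)) q.toMeasure) (x : ℤ) {θ : ℝ}
    (hθ : θ ≤ 0) : 1 - valueLimit q β x θ ≤ -θ * (x.toNat + incomeBound q β) :=
  le_of_tendsto ((tendsto_valueIter hβ x hθ).const_sub 1)
    (.of_forall fun n => one_sub_valueIter_le hβ hβ₁ hq n x _ hθ)

/-- The limit of value iteration solves the optimality equation. -/
theorem bellman_valueLimit (hβ : 0 ≤ β) (x : ℤ) {θ : ℝ} (hθ : θ ≤ 0) :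
    bellman q β (valueLimit q β) x θ = valueLimit q β x θ := by
  have hθβ := mul_nonpos_of_nonpos_of_nonneg hθ hβ
  refine tendsto_nhds_unique ?_
    ((tendsto_add_atTop_iff_nat 1).2 (tendsto_valueIter (q := q) hβ x hθ))
  refine Tendsto.finset_inf'_nhds_apply _ fun a _ => Tendsto.const_mul _ ?_
  refine tendsto_integral_of_dominated_convergence (fun _ => 1)
    (fun n => (measurable_of_countable _).aestronglyMeasurable) (integrable_const 1)
    (fun n => .of_forall fun y => ?_) (.of_forall fun y => tendsto_valueIter hβ y hθβ)
  have := unitValued_valueIter (q := q) hβ n y _ hθβ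
  rw [Real.norm_of_nonneg this.1]
  exact this.2

theorem one_le_valueIter_of_neg (hβ : 0 ≤ β) (n : ℕ) {x : ℤ} (hx : x < 0) :
    ∀ θ ≤ 0, 1 ≤ valueIter q β n x θ := by
  induction n with
  | zero => exact fun θ _ => le_rfl
  | succ n ih =>
    intro θ hθ
    refine Finset.le_inf' Finset.univ_nonempty _ fun a _ => ?_
    have ha : (pairOf x a).dividend = 0 := by
      have : (pairOf x a).dividend ≤ x.toNat := dividend_le (pairOf x a)
      omega
    rw [actionValue, ha, expectAfter_of_neg q _ (show (pairOf x a).surplus < 0 from hx)]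
    rw [Nat.cast_zero, mul_zero, Real.exp_zero, one_mul]
    exact ih _ (mul_nonpos_of_nonpos_of_nonneg hθ hβ)

theorem valueLimit_of_neg (hβ : 0 ≤ β) {x : ℤ} (hx : x < 0) {θ : ℝ} (hθ : θ ≤ 0) :
    valueLimit q β x θ = 1 :=
  le_antisymm (unitValued_valueLimit hβ x θ hθ).2
    (le_ciInf fun n => one_le_valueIter_of_neg hβ n hx θ hθ)

theorem valueLimit_le_actionValue (hβ : 0 ≤ β) {θ : ℝ} (hθ : θ ≤ 0) (p : Pair) :
    valueLimit q β p.surplus θ ≤ actionValue q β (valueLimit q β) θ p := by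
  rw [← bellman_valueLimit hβ _ hθ]
  exact Finset.inf'_le (fun a => actionValue q β (valueLimit q β) θ (pairOf p.surplus a))
    (Finset.mem_univ (⟨p.dividend, p.2⟩ : {a : ℕ // a ∈ actions p.surplus}))

/-- A decision rule attaining the minimum in the optimality equation exists. -/
theorem exists_actionValue_eq (hβ : 0 ≤ β) {θ : ℝ} (hθ : θ ≤ 0) :
    ∃ g : DecisionRule, ∀ x,
      actionValue q β (valueLimit q β) θ (pairOf x (g x)) = valueLimit q β x θ := by
  have h : ∀ x, ∃ a, actionValue q β (valueLimit q β) θ (pairOf x a) = valueLimit q β x θ := by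
    intro x
    obtain ⟨a, -, ha⟩ := Finset.exists_mem_eq_inf' (Finset.univ_nonempty)
      (fun a => actionValue q β (valueLimit q β) θ (pairOf x a))
    exact ⟨a, ha.symm.trans (bellman_valueLimit hβ x hθ)⟩
  exact ⟨fun x => (h x).choose, fun x => (h x).choose_spec⟩

end Bellman

/-! ### Integration along the controlled process -/

section Law

variable (q : PMF ℤ) (π : Policy) (x : ℤ)

instance : IsProbabilityMeasure (law q π x) := by
  unfold law
  infer_instance

/-- The chosen pair at time `k + 1`, when the trajectory up to time `k` is `h` and the surplus is
`y`. -/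
def nextPair (k : ℕ) (h : (_ : Finset.Iic k) → Pair) (y : ℤ) : Pair :=
  π.pair (k + 1) (fun i => h ⟨(i : ℕ), Finset.mem_Iic.2 (Nat.lt_succ_iff.1 i.2)⟩) y

theorem stepKernel_apply (k : ℕ) (h : (_ : Finset.Iic k) → Pair) :
    stepKernel q π k h =
      ((transition q (h ⟨k, Finset.mem_Iic.2 le_rfl⟩)).toMeasure).map (nextPair π k h) :=
  (PMF.toMeasure_map _ _ (measurable_of_countable _)).symm

theorem law_compProd (k : ℕ) :
    ((law q π x).map (Preorder.frestrictLe k)) ⊗ₘ (stepKernel q π k) =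
      (law q π x).map (fun ω => (Preorder.frestrictLe k ω, ω (k + 1))) := by
  have h := Kernel.partialTraj_compProd_eq_map_traj (X := fun _ => Pair)
    (κ := stepKernel q π) (Nat.zero_le k) (x₀ := fun _ => π.pair 0 Fin.elim0 x)
  rw [← Kernel.traj_map_frestrictLe_apply] at h
  exact h

/-- Conditioning on the trajectory up to time `k`, for a nonnegative function. -/
theorem lintegral_step (k : ℕ) (F : ((_ : Finset.Iic k) → Pair) → Pair → ℝ≥0∞) :
    ∫⁻ ω, F (Preorder.frestrictLe k ω) (ω (k + 1)) ∂(law q π x) =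
      ∫⁻ ω, ∫⁻ y, F (Preorder.frestrictLe k ω) (nextPair π k (Preorder.frestrictLe k ω) y)
        ∂(transition q (ω k)).toMeasure ∂(law q π x) := by
  have hF : Measurable (Function.uncurry F) := measurable_of_countable _
  have h1 := congrArg (fun μ => ∫⁻ z, Function.uncurry F z ∂μ) (law_compProd q π x k)
  beta_reduce at h1
  rw [Measure.lintegral_compProd hF, lintegral_map hF (by fun_prop),
    lintegral_map (measurable_of_countable _) (by fun_prop)] at h1
  refine h1.symm.trans (lintegral_congr fun ω => ?_)
  rw [stepKernel_apply, lintegral_map (measurable_of_countable _) (measurable_of_countable _)]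
  rfl

/-- Conditioning on the trajectory up to time `k`, for a function with values in `[0, 1]`. -/
theorem integral_step (k : ℕ) (F : ((_ : Finset.Iic k) → Pair) → Pair → ℝ)
    (h01 : ∀ h p, F h p ∈ Set.Icc (0 : ℝ) 1) :
    ∫ ω, F (Preorder.frestrictLe k ω) (ω (k + 1)) ∂(law q π x) =
      ∫ ω, ∫ y, F (Preorder.frestrictLe k ω) (nextPair π k (Preorder.frestrictLe k ω) y)
        ∂(transition q (ω k)).toMeasure ∂(law q π x) := by
  have hF : Measurable (Function.uncurry F) := measurable_of_countable _
  have h1 := congrArg (fun μ => ∫ z, Function.uncurry F z ∂μ) (law_compProd q π x k)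
  have : IsProbabilityMeasure ((law q π x).map (Preorder.frestrictLe (π := fun _ => Pair) k)) :=
    Measure.isProbabilityMeasure_map (by fun_prop)
  beta_reduce at h1
  rw [Measure.integral_compProd (integrable_of_mem_Icc hF fun z => h01 z.1 z.2),
    integral_map (by fun_prop) hF.aestronglyMeasurable,
    integral_map (by fun_prop) (measurable_of_countable _).aestronglyMeasurable] at h1
  refine h1.symm.trans (integral_congr_ae (.of_forall fun ω => ?_))
  simp only
  rw [stepKernel_apply, integral_map (measurable_of_countable _).aemeasurable
    (measurable_of_countable _).aestronglyMeasurable]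
  rfl

theorem law_map_zero : (law q π x).map (fun ω => ω 0) = Measure.dirac (π.pair 0 Fin.elim0 x) := by
  have h := Kernel.traj_map_frestrictLe_apply (X := fun _ => Pair) (κ := stepKernel q π) 0 0
    (fun _ => π.pair 0 Fin.elim0 x)
  rw [Kernel.partialTraj_self, Kernel.id_apply] at h
  have h2 := congrArg (Measure.map fun r : (_ : Finset.Iic 0) → Pair =>
    r ⟨0, Finset.mem_Iic.2 le_rfl⟩) h
  rw [Measure.map_map (by fun_prop) (by fun_prop),
    Measure.map_dirac' (measurable_of_countable _)] at h2
  exact h2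

theorem integral_zero_coord (f : Pair → ℝ) :
    ∫ ω, f (ω 0) ∂(law q π x) = f (π.pair 0 Fin.elim0 x) := by
  rw [← integral_map (φ := fun ω : ℕ → Pair => ω 0) (f := f)
    (measurable_pi_apply 0).aemeasurable (measurable_of_countable f).aestronglyMeasurable,
    law_map_zero, integral_dirac]

theorem lintegral_zero_coord (f : Pair → ℝ≥0∞) :
    ∫⁻ ω, f (ω 0) ∂(law q π x) = f (π.pair 0 Fin.elim0 x) := by
  rw [← lintegral_map (g := fun ω : ℕ → Pair => ω 0) (f := f) (measurable_of_countable f)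
    (measurable_pi_apply 0), law_map_zero, lintegral_dirac]

/-- The expected surplus grows at most linearly in time, under every policy. -/
theorem lintegral_surplus_le
    (hq : Integrable (fun z : ℤ => ((max z 0 : ℤ) : ℝ)) q.toMeasure) (k : ℕ) :
    ∫⁻ ω, ENNReal.ofReal ((ω k).surplus.toNat : ℝ) ∂(law q π x) ≤
      ENNReal.ofReal (x.toNat + k * meanPos q) := by
  have hm := meanPos_nonneg q
  induction k with
  | zero =>
    rw [lintegral_zero_coord q π x (fun p => ENNReal.ofReal (p.surplus.toNat : ℝ))]
    simp [Policy.pair, Pair.surplus]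
  | succ k ih =>
    rw [lintegral_step q π x k (fun _ p => ENNReal.ofReal (p.surplus.toNat : ℝ))]
    calc _ ≤ ∫⁻ ω, (ENNReal.ofReal ((ω k).surplus.toNat : ℝ) + ENNReal.ofReal (meanPos q))
              ∂(law q π x) := by
            refine lintegral_mono fun ω => (lintegral_toNat_transition_le q hq (ω k)).trans ?_
            rw [← ENNReal.ofReal_add (by positivity) hm]
            exact ENNReal.ofReal_le_ofReal (by simp)
      _ ≤ ENNReal.ofReal (x.toNat + k * meanPos q) + ENNReal.ofReal (meanPos q) := by
            rw [lintegral_add_right _ measurable_const, lintegral_const, measure_univ, mul_one]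
            gcongr
      _ = _ := by
            rw [← ENNReal.ofReal_add (by positivity) hm]
            push_cast
            ring_nf

theorem integrable_surplus
    (hq : Integrable (fun z : ℤ => ((max z 0 : ℤ) : ℝ)) q.toMeasure) (k : ℕ) :
    Integrable (fun ω => ((ω k).surplus.toNat : ℝ)) (law q π x) := by
  have hmeas : Measurable fun ω : ℕ → Pair => ((ω k).surplus.toNat : ℝ) :=
    (measurable_of_countable fun p : Pair => (p.surplus.toNat : ℝ)).comp (measurable_pi_apply k)
  refine ⟨hmeas.aestronglyMeasurable, ?_⟩
  rw [hasFiniteIntegral_iff_ofReal (.of_forall fun y => by positivity)]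
  exact (lintegral_surplus_le q π x hq k).trans_lt ENNReal.ofReal_lt_top

theorem integral_surplus_le
    (hq : Integrable (fun z : ℤ => ((max z 0 : ℤ) : ℝ)) q.toMeasure) (k : ℕ) :
    ∫ ω, ((ω k).surplus.toNat : ℝ) ∂(law q π x) ≤ x.toNat + k * meanPos q := by
  have hm := meanPos_nonneg q
  rw [integral_eq_lintegral_of_nonneg_ae (.of_forall fun y => by positivity)
    (integrable_surplus q π x hq k).1]
  exact ENNReal.toReal_le_of_le_ofReal (by positivity) (lintegral_surplus_le q π x hq k)

end Law

/-! ### Discounted dividends -/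

/-- The discounted dividends paid before time `k`. -/
noncomputable def partialTotal (β : ℝ) (k : ℕ) (ω : ℕ → Pair) : ℝ :=
  ∑ j ∈ Finset.range k, β ^ j * ((ω j).dividend : ℝ)

theorem partialTotal_nonneg {β : ℝ} (hβ : 0 ≤ β) (k : ℕ) (ω : ℕ → Pair) :
    0 ≤ partialTotal β k ω :=
  Finset.sum_nonneg fun _ _ => by positivity

theorem measurable_dividend (j : ℕ) : Measurable fun ω : ℕ → Pair => ((ω j).dividend : ℝ) :=
  (measurable_of_countable fun p : Pair => (p.dividend : ℝ)).comp (measurable_pi_apply j)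

theorem measurable_partialTotal (β : ℝ) (k : ℕ) : Measurable (partialTotal β k) :=
  Finset.measurable_fun_sum _ fun j _ => (measurable_dividend j).const_mul _

/-- The exponentials of the partial sums converge on every path, also when the total is infinite:
this is where the value `0` of `expMul` at `∞` enters. -/
theorem tendsto_exp_partialTotal {β θ : ℝ} (hβ : 0 ≤ β) (hθ : θ < 0) (ω : ℕ → Pair) :
    Tendsto (fun k => Real.exp (θ * partialTotal β k ω)) atTop (𝓝 (expMul θ (total β ω))) := by
  have hsum : Tendsto (fun k => ENNReal.ofReal (partialTotal β k ω)) atTop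
      (𝓝 (total β ω)) := by
    have h := ENNReal.tendsto_nat_tsum fun k => ENNReal.ofReal (β ^ k * ((ω k).dividend : ℝ))
    refine h.congr fun k => ?_
    rw [partialTotal, ENNReal.ofReal_sum_of_nonneg fun _ _ => by positivity]
  by_cases ht : total β ω = ∞
  · rw [expMul, if_pos ht]
    rw [ht] at hsum
    exact Real.tendsto_exp_atBot.comp
      ((ENNReal.tendsto_ofReal_nhds_top.1 hsum).const_mul_atTop_of_neg hθ)
  · rw [expMul, if_neg ht]
    have h := (ENNReal.tendsto_toReal ht).comp hsum
    refine (Real.continuous_exp.tendsto _).comp (Tendsto.const_mul θ ?_)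
    exact h.congr fun k => ENNReal.toReal_ofReal (partialTotal_nonneg hβ k ω)

theorem exp_partialTotal_mem_Icc {β θ : ℝ} (hβ : 0 ≤ β) (hθ : θ ≤ 0) (k : ℕ) (ω : ℕ → Pair) :
    Real.exp (θ * partialTotal β k ω) ∈ Set.Icc (0 : ℝ) 1 := by
  simpa using exp_mul_mem_Icc hθ (partialTotal_nonneg hβ k ω) (c := 1) (by simp)

theorem tendsto_integral_exp_partialTotal {β θ : ℝ} (hβ : 0 ≤ β) (hθ : θ < 0) (q : PMF ℤ)
    (π : Policy) (x : ℤ) :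
    Tendsto (fun k => ∫ ω, Real.exp (θ * partialTotal β k ω) ∂(law q π x)) atTop
      (𝓝 (costOf q β π x θ)) := by
  refine tendsto_integral_of_dominated_convergence (fun _ => 1)
    (fun k => ((measurable_partialTotal β k).const_mul θ).exp.aestronglyMeasurable)
    (integrable_const 1) (fun k => .of_forall fun ω => ?_)
    (.of_forall fun ω => tendsto_exp_partialTotal hβ hθ ω)
  have := exp_partialTotal_mem_Icc hβ hθ.le k ω
  rw [Real.norm_of_nonneg this.1]
  exact this.2

theorem costOf_nonneg (q : PMF ℤ) (β : ℝ) (π : Policy) (x : ℤ) (θ : ℝ) :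
    0 ≤ costOf q β π x θ := by
  refine integral_nonneg fun ω => ?_
  change 0 ≤ expMul θ (total β ω)
  unfold expMul
  split_ifs <;> positivity

/-! ### Verification -/

section Verification

variable {q : PMF ℤ} {β θ : ℝ}

theorem mul_pow_nonpos (hβ : 0 ≤ β) (hθ : θ ≤ 0) (k : ℕ) : θ * β ^ k ≤ 0 :=
  mul_nonpos_of_nonpos_of_nonneg hθ (pow_nonneg hβ k)

/-- The cost of continuing optimally after the action at time `k`, given the trajectory up to that
time. In expectation it increases with `k`, and it is constant along an optimal policy. -/
noncomputable def costToGo (q : PMF ℤ) (β θ : ℝ) (k : ℕ) (ω : ℕ → Pair) : ℝ :=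
  Real.exp (θ * partialTotal β k ω) * actionValue q β (valueLimit q β) (θ * β ^ k) (ω k)

theorem costToGo_eq (k : ℕ) (ω : ℕ → Pair) :
    costToGo q β θ k ω = Real.exp (θ * partialTotal β (k + 1) ω) *
      expectAfter q (fun y => valueLimit q β y (θ * β ^ (k + 1))) (ω k) := by
  rw [costToGo, actionValue, ← mul_assoc, ← Real.exp_add, partialTotal, partialTotal,
    Finset.sum_range_succ, pow_succ]
  ring_nf

theorem measurable_of_past (k : ℕ) (f : ((_ : Finset.Iic k) → Pair) → ℝ) :
    Measurable fun ω : ℕ → Pair => f (Preorder.frestrictLe k ω) :=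
  (measurable_of_countable f).comp (Preorder.measurable_frestrictLe k)

theorem measurable_costToGo (k : ℕ) : Measurable (costToGo q β θ k) :=
  ((measurable_partialTotal β k).const_mul θ).exp.mul
    ((measurable_of_countable (actionValue q β (valueLimit q β) (θ * β ^ k))).comp
      (measurable_pi_apply k))

theorem costToGo_mem_Icc (hβ : 0 ≤ β) (hθ : θ ≤ 0) (k : ℕ) (ω : ℕ → Pair) :
    costToGo q β θ k ω ∈ Set.Icc (0 : ℝ) 1 :=
  exp_mul_mem_Icc hθ (partialTotal_nonneg hβ k ω)
    ((unitValued_valueLimit hβ).actionValue_mem_Icc hβ (mul_pow_nonpos hβ hθ k) _)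

theorem integral_costToGo_zero (π : Policy) (x : ℤ) :
    ∫ ω, costToGo q β θ 0 ω ∂(law q π x) =
      actionValue q β (valueLimit q β) θ (π.pair 0 Fin.elim0 x) := by
  simp only [costToGo, partialTotal, Finset.range_zero, Finset.sum_empty, mul_zero, Real.exp_zero,
    one_mul, pow_zero, mul_one]
  exact integral_zero_coord q π x _

theorem partialTotal_succ_eq (k : ℕ) (ω : ℕ → Pair) :
    partialTotal β (k + 1) ω =
      ∑ j : Finset.Iic k, β ^ (j : ℕ) * ((Preorder.frestrictLe k ω j).dividend : ℝ) := by
  rw [partialTotal, Nat.range_succ_eq_Iic, ← Finset.sum_coe_sort]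
  rfl

/-- The expected cost to go at time `k + 1`, conditioned on the trajectory up to time `k`. -/
theorem integral_costToGo_succ (hβ : 0 ≤ β) (hθ : θ ≤ 0) (π : Policy) (x : ℤ) (k : ℕ) :
    ∫ ω, costToGo q β θ (k + 1) ω ∂(law q π x) =
      ∫ ω, Real.exp (θ * partialTotal β (k + 1) ω) * expectAfter q (fun y =>
        actionValue q β (valueLimit q β) (θ * β ^ (k + 1))
          (nextPair π k (Preorder.frestrictLe k ω) y)) (ω k) ∂(law q π x) := by
  have h := integral_step q π x k (fun h p =>
    Real.exp (θ * ∑ j : Finset.Iic k, β ^ (j : ℕ) * ((h j).dividend : ℝ)) *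
      actionValue q β (valueLimit q β) (θ * β ^ (k + 1)) p) fun h p =>
      exp_mul_mem_Icc hθ (Finset.sum_nonneg fun _ _ => by positivity)
        ((unitValued_valueLimit hβ).actionValue_mem_Icc hβ (mul_pow_nonpos hβ hθ _) _)
  simp only [← partialTotal_succ_eq, integral_const_mul] at h
  exact h

theorem integral_costToGo_le_succ (hβ : 0 ≤ β) (hθ : θ ≤ 0) (π : Policy) (x : ℤ) (k : ℕ) :
    ∫ ω, costToGo q β θ k ω ∂(law q π x) ≤ ∫ ω, costToGo q β θ (k + 1) ω ∂(law q π x) := by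
  rw [integral_costToGo_succ hβ hθ]
  have hk := mul_pow_nonpos hβ hθ (k + 1)
  have hA : ∀ p, actionValue q β (valueLimit q β) (θ * β ^ (k + 1)) p ∈ Set.Icc (0 : ℝ) 1 :=
    (unitValued_valueLimit hβ).actionValue_mem_Icc hβ hk
  refine integral_mono (integrable_of_mem_Icc (measurable_costToGo k)
    (costToGo_mem_Icc hβ hθ k)) (integrable_of_mem_Icc ?_ fun ω => ?_) fun ω => ?_
  · exact ((measurable_partialTotal β (k + 1)).const_mul θ).exp.mul
      (measurable_of_past k fun h => expectAfter q (fun y =>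
        actionValue q β (valueLimit q β) (θ * β ^ (k + 1)) (nextPair π k h y))
          (h ⟨k, Finset.mem_Iic.2 le_rfl⟩))
  · exact exp_mul_mem_Icc hθ (partialTotal_nonneg hβ _ ω) (expectAfter_mem_Icc q (fun y => hA _) _)
  · rw [costToGo_eq]
    refine mul_le_mul_of_nonneg_left (expectAfter_mono q (fun y => unitValued_valueLimit hβ y _ hk)
      (fun y => hA _) (fun y => ?_) _) (Real.exp_pos _).le
    exact valueLimit_le_actionValue hβ hk (nextPair π k _ y)

/-- The decision rules `g` attain the minima in the optimality equations that a problem with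
initial parameter `θ` meets in the course of time. -/
def IsGreedy (q : PMF ℤ) (β θ : ℝ) (g : ℕ → DecisionRule) : Prop :=
  ∀ k x, actionValue q β (valueLimit q β) (θ * β ^ k) (pairOf x (g k x)) =
    valueLimit q β x (θ * β ^ k)

theorem integral_costToGo_of_isGreedy (hβ : 0 ≤ β) (hθ : θ ≤ 0) {g : ℕ → DecisionRule}
    (hg : IsGreedy q β θ g) (x : ℤ) (k : ℕ) :
    ∫ ω, costToGo q β θ k ω ∂(law q (markovPolicy g) x) = valueLimit q β x θ := by
  induction k with
  | zero =>
    rw [integral_costToGo_zero]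
    have := hg 0 x
    rw [pow_zero, mul_one] at this
    exact this
  | succ k ih =>
    rw [integral_costToGo_succ hβ hθ, ← ih]
    refine integral_congr_ae (.of_forall fun ω => ?_)
    simp only [costToGo_eq]
    congr 2
    funext y
    exact hg (k + 1) y

theorem costToGo_le_exp (hβ : 0 ≤ β) (hθ : θ ≤ 0) (k : ℕ) (ω : ℕ → Pair) :
    costToGo q β θ k ω ≤ Real.exp (θ * partialTotal β (k + 1) ω) := by
  rw [costToGo_eq]
  exact mul_le_of_le_one_right (Real.exp_pos _).le (expectAfter_mem_Icc q
    (fun y => unitValued_valueLimit hβ y _ (mul_pow_nonpos hβ hθ _)) _).2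

theorem integrable_exp_partialTotal (hβ : 0 ≤ β) (hθ : θ ≤ 0) (π : Policy) (x : ℤ) (k : ℕ) :
    Integrable (fun ω => Real.exp (θ * partialTotal β k ω)) (law q π x) :=
  integrable_of_mem_Icc ((measurable_partialTotal β k).const_mul θ).exp
    (exp_partialTotal_mem_Icc hβ hθ k)

/-- No policy beats the limit of value iteration. -/
theorem valueLimit_le_costOf (hβ : 0 ≤ β) (hθ : θ < 0) (π : Policy) (x : ℤ) :
    valueLimit q β x θ ≤ costOf q β π x θ := by
  refine ge_of_tendsto ((tendsto_add_atTop_iff_nat 1).2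
    (tendsto_integral_exp_partialTotal hβ hθ q π x)) (.of_forall fun k => ?_)
  have h0 : valueLimit q β x θ ≤ ∫ ω, costToGo q β θ 0 ω ∂(law q π x) := by
    rw [integral_costToGo_zero]
    exact valueLimit_le_actionValue hβ hθ.le (π.pair 0 Fin.elim0 x)
  calc _ ≤ _ := h0
    _ ≤ ∫ ω, costToGo q β θ k ω ∂(law q π x) :=
        monotone_nat_of_le_succ (integral_costToGo_le_succ hβ hθ.le π x) (Nat.zero_le k)
    _ ≤ _ := integral_mono (integrable_of_mem_Icc (measurable_costToGo k)
        (costToGo_mem_Icc hβ hθ.le k)) (integrable_exp_partialTotal hβ hθ.le π x _)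
        (costToGo_le_exp hβ hθ.le k)

/-- The cost of the present dividends differs little from the cost to go: the future discounted
dividends are negligible, because the expected surplus grows only linearly. -/
theorem integral_exp_partialTotal_sub_le (hβ : 0 ≤ β) (hβ₁ : β < 1) (hθ : θ ≤ 0)
    (hq : Integrable (fun z : ℤ => ((max z 0 : ℤ) : ℝ)) q.toMeasure) (π : Policy) (x : ℤ) (k : ℕ) :
    ∫ ω, Real.exp (θ * partialTotal β (k + 1) ω) ∂(law q π x) -
        ∫ ω, costToGo q β θ k ω ∂(law q π x) ≤
      -(θ * β ^ (k + 1)) * (x.toNat + k * meanPos q + (meanPos q + incomeBound q β)) := by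
  have hk := mul_pow_nonpos hβ hθ (k + 1)
  have hs := integrable_surplus q π x hq k
  have hN : Integrable (costToGo q β θ k) (law q π x) :=
    integrable_of_mem_Icc (measurable_costToGo k) (costToGo_mem_Icc hβ hθ k)
  have hE := integrable_exp_partialTotal (q := q) hβ hθ π x (k + 1)
  rw [← integral_sub hE hN]
  calc _ ≤ ∫ ω, -(θ * β ^ (k + 1)) *
          (((ω k).surplus.toNat : ℝ) + (meanPos q + incomeBound q β)) ∂(law q π x) := by
        refine integral_mono (hE.sub hN) ((hs.add (integrable_const _)).const_mul _) fun ω => ?_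
        have hu := fun y => unitValued_valueLimit (q := q) hβ y _ hk
        have h1 := one_sub_expectAfter_le q hq (t := -(θ * β ^ (k + 1))) (by linarith) hu
          (fun y => one_sub_valueLimit_le hβ hβ₁ hq y hk) (ω k)
        have h2 := (exp_partialTotal_mem_Icc hβ hθ (k + 1) ω).2
        have h3 := (expectAfter_mem_Icc q hu (ω k)).2
        have h4 := mul_nonneg (sub_nonneg.2 h2) (sub_nonneg.2 h3)
        have h5 : 0 ≤ -(θ * β ^ (k + 1)) * ((ω k).dividend : ℝ) :=
          mul_nonneg (by linarith) (by positivity)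
        simp only [costToGo_eq]
        linarith
    _ = -(θ * β ^ (k + 1)) * (∫ ω, ((ω k).surplus.toNat : ℝ) ∂(law q π x) +
          (meanPos q + incomeBound q β)) := by
        rw [integral_const_mul, integral_add hs (integrable_const _)]
        simp
    _ ≤ _ := by
        refine mul_le_mul_of_nonneg_left ?_ (by linarith)
        linarith [integral_surplus_le q π x hq k]

/-- Greedy Markov policies attain the limit of value iteration. -/
theorem costOf_of_isGreedy (hβ : 0 ≤ β) (hβ₁ : β < 1) (hθ : θ < 0)
    (hq : Integrable (fun z : ℤ => ((max z 0 : ℤ) : ℝ)) q.toMeasure) {g : ℕ → DecisionRule}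
    (hg : IsGreedy q β θ g) (x : ℤ) :
    costOf q β (markovPolicy g) x θ = valueLimit q β x θ := by
  refine le_antisymm ?_ (valueLimit_le_costOf hβ hθ _ x)
  rw [← sub_nonpos]
  set c : ℝ := x.toNat + meanPos q + incomeBound q β
  have h0 : Tendsto (fun k : ℕ => -(θ * β) * (c * β ^ k + meanPos q * (k * β ^ k))) atTop
      (𝓝 (-(θ * β) * (c * 0 + meanPos q * 0))) :=
    (((tendsto_pow_atTop_nhds_zero_of_lt_one hβ hβ₁).const_mul c).add
      ((tendsto_self_mul_const_pow_of_lt_one hβ hβ₁).const_mul _)).const_mul _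
  simp only [mul_zero, add_zero] at h0
  refine le_of_tendsto_of_tendsto' (((tendsto_add_atTop_iff_nat 1).2
    (tendsto_integral_exp_partialTotal hβ hθ q (markovPolicy g) x)).sub_const _) h0 fun k => ?_
  have h := integral_exp_partialTotal_sub_le hβ hβ₁ hθ.le hq (markovPolicy g) x k
  rw [integral_costToGo_of_isGreedy hβ hθ.le hg] at h
  refine h.trans_eq ?_
  simp only [c]
  ring

/-- The optimal cost is the limit of value iteration. -/
theorem cost_eq_valueLimit (hβ : 0 ≤ β) (hβ₁ : β < 1) (hθ : θ < 0)
    (hq : Integrable (fun z : ℤ => ((max z 0 : ℤ) : ℝ)) q.toMeasure) (x : ℤ) :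
    cost q β x θ = valueLimit q β x θ := by
  choose g hg using fun k : ℕ => exists_actionValue_eq (q := q) hβ (mul_pow_nonpos hβ hθ.le k)
  have hgr : IsGreedy q β θ g := hg
  refine le_antisymm ?_ ?_
  · rw [← costOf_of_isGreedy hβ hβ₁ hθ hq hgr x]
    exact ciInf_le ⟨0, by rintro _ ⟨π, rfl⟩; exact costOf_nonneg q β π x θ⟩ (markovPolicy g)
  · have : Nonempty Policy := ⟨markovPolicy g⟩
    exact le_ciInf fun π => valueLimit_le_costOf hβ hθ π x

/-- The series `G(x - a, θ β)` is the expected cost after the pair `(x, a)`; at a negative surplus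
the cost is `1`. -/
theorem costAfter_eq_expectAfter (hβ : 0 ≤ β) (hβ₁ : β < 1) (hθ : θ < 0)
    (hq : Integrable (fun z : ℤ => ((max z 0 : ℤ) : ℝ)) q.toMeasure) {p : Pair}
    (hp : 0 ≤ p.surplus) :
    costAfter q β (p.surplus - p.dividend) θ =
      expectAfter q (fun y => valueLimit q β y θ) p := by
  rw [expectAfter_of_nonneg q _ hp, PMF.integral_eq_tsum _ _ (integrable_of_mem_Icc
    (measurable_of_countable _) fun z => unitValued_valueLimit hβ _ θ hθ.le), costAfter]
  refine tsum_congr fun k => ?_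
  rw [smul_eq_mul, mul_comm]
  congr 1
  split_ifs with h
  · exact cost_eq_valueLimit hβ hβ₁ hθ hq _
  · exact (valueLimit_of_neg hβ (by omega) hθ.le).symm

theorem objective_eq_actionValue (hβ : 0 < β) (hβ₁ : β < 1) (hθ : θ < 0)
    (hq : Integrable (fun z : ℤ => ((max z 0 : ℤ) : ℝ)) q.toMeasure) {x : ℤ} (hx : 0 ≤ x)
    (a : {a : ℕ // a ∈ actions x}) :
    objective q β x θ a = actionValue q β (valueLimit q β) θ (pairOf x a) := by
  rw [objective, actionValue, ← costAfter_eq_expectAfter hβ.le hβ₁ (mul_neg_of_neg_of_pos hθ hβ) hq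
    (show 0 ≤ (pairOf x a).surplus from hx)]
  rfl

theorem eq_zero_of_mem_actions {x : ℤ} (hx : x < 0) {a : ℕ} (ha : a ∈ actions x) : a = 0 := by
  have := Finset.mem_range.1 ha
  omega

/-- The largest minimisers of the objective form a greedy policy. -/
theorem isGreedy_largestMinimiser (hβ : 0 < β) (hβ₁ : β < 1) (hθ : θ < 0)
    (hq : Integrable (fun z : ℤ => ((max z 0 : ℤ) : ℝ)) q.toMeasure) :
    IsGreedy q β θ fun n x => ⟨largestMinimiser q β x (θ * β ^ n),
      (largestMinimiser_isGreatest q β x (θ * β ^ n)).1.1⟩ := by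
  intro k x
  have hk : θ * β ^ k < 0 := mul_neg_of_neg_of_pos hθ (pow_pos hβ k)
  have hmin := (largestMinimiser_isGreatest q β x (θ * β ^ k)).1
  obtain ⟨g, hg⟩ := exists_actionValue_eq (q := q) hβ.le hk.le
  refine le_antisymm ?_ (valueLimit_le_actionValue hβ.le hk.le (pairOf x _))
  rw [← hg x]
  rcases lt_or_ge x 0 with hx | hx
  · -- After ruin, `0` is the only admissible dividend.
    exact le_of_eq (congrArg (fun a => actionValue q β _ _ (pairOf x a)) (Subtype.ext
      ((eq_zero_of_mem_actions hx hmin.1).trans (eq_zero_of_mem_actions hx (g x).2).symm)))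
  · rw [← objective_eq_actionValue hβ hβ₁ hk hq hx, ← objective_eq_actionValue hβ hβ₁ hk hq hx]
    exact hmin.2 _ (g x).2

end Verification

theorem expectedUtility_eq (q : PMF ℤ) (β γ : ℝ) (π : Policy) (x : ℤ) :
    expectedUtility q β γ π x = 1 / γ * costOf q β π x γ :=
  integral_const_mul _ _

end Dividend

theorem mainTheorem1 (q : PMF ℤ) (β γ : ℝ) (hβ₀ : 0 < β) (hβ₁ : β < 1) (hγ : γ < 0)
    (hA1 : Integrable (fun z : ℤ => ((max z 0 : ℤ) : ℝ)) q.toMeasure)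
    (hA2 : 0 < q.toMeasure {z : ℤ | z < 0}) (x : ℤ) :
    IsGreatest (Set.range fun π : Dividend.Policy => Dividend.expectedUtility q β γ π x)
      (Dividend.expectedUtility q β γ (Dividend.optimalPolicy q β γ) x) ∧
    Dividend.optimalUtility q β γ x =
      Dividend.expectedUtility q β γ (Dividend.optimalPolicy q β γ) x ∧
    Dividend.expectedUtility q β γ (Dividend.optimalPolicy q β γ) x =
      1 / γ * Dividend.costOf q β (Dividend.optimalPolicy q β γ) x γ ∧
    1 / γ * Dividend.costOf q β (Dividend.optimalPolicy q β γ) x γ =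
      1 / γ * Dividend.cost q β x γ := by
  have hopt : Dividend.costOf q β (Dividend.optimalPolicy q β γ) x γ =
      Dividend.valueLimit q β x γ :=
    Dividend.costOf_of_isGreedy hβ₀.le hβ₁ hγ hA1
      (Dividend.isGreedy_largestMinimiser hβ₀ hβ₁ hγ hA1) x
  have hgr : IsGreatest
      (Set.range fun π : Dividend.Policy => Dividend.expectedUtility q β γ π x)
      (Dividend.expectedUtility q β γ (Dividend.optimalPolicy q β γ) x) := by
    refine ⟨⟨_, rfl⟩, ?_⟩
    rintro _ ⟨π, rfl⟩
    simp only [Dividend.expectedUtility_eq, hopt]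
    exact mul_le_mul_of_nonpos_left (Dividend.valueLimit_le_costOf hβ₀.le hγ π x)
      (one_div_neg.2 hγ).le
  refine ⟨hgr, hgr.csSup_eq, Dividend.expectedUtility_eq q β γ _ x, ?_⟩
  rw [hopt, Dividend.cost_eq_valueLimit hβ₀.le hβ₁ hγ hA1]
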